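/- A \emph{semilattice-ordered monoid} (s$\ell$-monoid) is a monoid $M$ with a join-semilattice order such that $a(b\vee c)=ab\vee ac$ and $(a\vee b)c=ac\vee bc$. It is \emph{integral} if $a\le 1$ for all $a$; \emph{cancellative} if $ax\le bx$ implies $a\le b$ and $xa\le xb$ implies $a\le b$; \emph{integrally closed} if $ax\le a$ implies $x\le 1$ and $xa\le a$ implies $x\le 1$. A commutative s$\ell$-monoid $M$ satisfies the \emph{square condition} if for all integers $n\ge 1$, $m\ge 0$, all $x_1,\dots,x_m,y\in M$, and every way of filling an $n\times n$ table with the indices $1,\dots,m$ such that each index occurs exactly once in each row (cells may be empty or contain several indices), the following implication holds: if for each column $j$ the product $\prod_{i=1}^n \pi_{ij}$ is $\le y$, where $\pi_{ij}$ is the product of all $x_k$ with $k$ in the cell $(i,j)$ (and $\pi_{ij}=1$ for an empty cell), then $x_1\cdots x_m\le y$. A \emph{nucleus} on an s$\ell$-monoid $N$ is a closure operator $\gamma$ on $N$ with $\gamma(a)\gamma(b)\le\gamma(ab)$. The \emph{nuclear image} $N_\gamma$ is the s$\ell$-monoid of all $a$ with $\gamma(a)=a$, with the order of $N$, the product $a\cdot_\gamma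 b=\gamma(ab)$, the unit $\gamma(1)$ and the joins $a\vee_\gamma b=\gamma(a\vee b)$; an s$\ell$-monoid is \emph{a nuclear image of} $N$ if it is isomorphic to $N_\gamma$ for some nucleus $\gamma$ on $N$. A \emph{sub-s$\ell$-monoid} is a submonoid closed under binary joins. The \emph{negative cone} of an Abelian $\ell$-group $G$ is its sub-s$\ell$-monoid $\{a\in G: a\le 1\}$. \textbf{Theorem.} Let $M$ be a commutative s$\ell$-monoid. (1) The following are equivalent: (a) $M$ is integrally closed and satisfies the square condition; (b) $M$ is a nuclear image of a commutative cancellative s$\ell$-monoid; (c) $M$ is a nuclear image of a sub-s$\ell$-monoid of an Abelian $\ell$-group. (2) The following are equivalent: (a) $M$ is integrally closed, integral, and satisfies the square condition; (b) $M$ is a nuclear image of an integral commutative cancellative s$\ell$-monoid; (c) $M$ is a nuclear image of an integral sub-s$\ell$-monoid of an Abelian $\ell$-group; (d) $M$ is a nuclear image of a sub-s$\ell$-monoid of the negative cone of an Abelian $\ell$-group. -/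

import Mathlib

universe u v

/-- A monoid which is also a join semilattice is a semilattice-ordered monoid (sl-monoid) if
multiplication distributes over binary joins on both sides. Isotonicity of multiplication
follows, see the two instances below. -/
class IsSlMonoid (M : Type u) [Monoid M] [SemilatticeSup M] : Prop where
  mul_sup : ∀ a b c : M, a * (b ⊔ c) = a * b ⊔ a * c
  sup_mul : ∀ a b c : M, (a ⊔ b) * c = a * c ⊔ b * c

instance IsSlMonoid.mulLeftMono (M : Type u) [Monoid M] [SemilatticeSup M] [IsSlMonoid M] :
    MulLeftMono M where
  elim a b c h := by
    have h' : a * (b ⊔ c) = a * b ⊔ a * c := IsSlMonoid.mul_sup a b c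
    rw [sup_eq_right.2 h] at h'
    exact sup_eq_right.1 h'.symm

instance IsSlMonoid.mulRightMono (M : Type u) [Monoid M] [SemilatticeSup M] [IsSlMonoid M] :
    MulRightMono M where
  elim c a b h := by
    have h' : (a ⊔ b) * c = a * c ⊔ b * c := IsSlMonoid.sup_mul a b c
    rw [sup_eq_right.2 h] at h'
    exact sup_eq_right.1 h'.symm

/-- Every Abelian lattice-ordered group is an sl-monoid. -/
instance IsSlMonoid.ofLatticeOrderedGroup (G : Type u) [CommGroup G] [Lattice G]
    [IsOrderedMonoid G] : IsSlMonoid G where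
  mul_sup a b c := _root_.mul_sup b c a
  sup_mul a b c := _root_.sup_mul a b c

namespace Pomonoid

/-- The unit is the top element. -/
def Integral (M : Type u) [Monoid M] [PartialOrder M] : Prop :=
  ∀ a : M, a ≤ 1

def IntegrallyClosed (M : Type u) [Monoid M] [PartialOrder M] : Prop :=
  (∀ a x : M, a * x ≤ a → x ≤ 1) ∧ (∀ a x : M, x * a ≤ a → x ≤ 1)

/-- Cancellativity in the ordered sense. -/
def Cancellative (M : Type u) [Monoid M] [PartialOrder M] : Prop :=
  (∀ a b x : M, a * x ≤ b * x → a ≤ b) ∧ (∀ a b x : M, x * a ≤ x * b → a ≤ b)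

/-- An `n × n` table filled with the variables `x 0, …, x (m - 1)`, each occurring exactly once
in each row, is given by the map `f` such that `x k` occurs in row `i` in the column `f i k`.
This is the product of the variables in the cell in row `i` and column `j`; an empty cell has
product `1`. -/
def tableCell {M : Type u} [CommMonoid M] {n m : ℕ} (f : Fin n → Fin m → Fin n) (x : Fin m → M)
    (i j : Fin n) : M :=
  ∏ k : Fin m with f i k = j, x k

/-- The square condition: in each non-degenerate square table, if the product of each column is
below `y`, then so is the product of all the variables (i.e. the product of each row). -/
def SquareCondition (M : Type u) [CommMonoid M] [PartialOrder M] : Prop :=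
  ∀ n m : ℕ, 1 ≤ n → ∀ (f : Fin n → Fin m → Fin n) (x : Fin m → M) (y : M),
    (∀ j : Fin n, ∏ i : Fin n, tableCell f x i j ≤ y) → ∏ k : Fin m, x k ≤ y

/-- A nucleus: a closure operator `γ` such that `γ a * γ b ≤ γ (a * b)`. -/
structure Nucleus (M : Type u) [Monoid M] [PartialOrder M] extends ClosureOperator M where
  map_mul_le' : ∀ a b : M, toFun a * toFun b ≤ toFun (a * b)

/-- The set of closed elements of a nucleus. -/
def NuclearImage {M : Type u} [Monoid M] [PartialOrder M] (γ : Nucleus M) : Type u :=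
  {a : M // γ.toClosureOperator a = a}

namespace NuclearImage

section Order

variable {M : Type u} [Monoid M] [PartialOrder M] (γ : Nucleus M)

/-- The order inherited from `M`. -/
instance : PartialOrder (NuclearImage γ) :=
  inferInstanceAs (PartialOrder {a : M // γ.toClosureOperator a = a})

/-- The closure of an element, as an element of the nuclear image. -/
def close (a : M) : NuclearImage γ :=
  ⟨γ.toClosureOperator a, γ.toClosureOperator.idempotent a⟩

theorem close_le_iff (a : M) (b : NuclearImage γ) : close γ a ≤ b ↔ a ≤ b.1 := by
  constructor
  · intro h
    exact le_trans (γ.toClosureOperator.le_closure a) h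
  · intro h
    have h' := γ.toClosureOperator.monotone h
    rw [b.2] at h'
    exact h'

instance : Mul (NuclearImage γ) := ⟨fun a b => close γ (a.1 * b.1)⟩

instance : One (NuclearImage γ) := ⟨close γ 1⟩

theorem mul_def (a b : NuclearImage γ) : a * b = close γ (a.1 * b.1) := rfl

theorem one_def : (1 : NuclearImage γ) = close γ 1 := rfl

theorem close_coe (a : NuclearImage γ) : close γ a.1 = a := Subtype.ext a.2

variable [MulLeftMono M] [MulRightMono M]

theorem close_mul_close (a b : M) : close γ a * close γ b = close γ (a * b) := by
  apply le_antisymm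
  · exact (close_le_iff γ _ _).2 (γ.map_mul_le' a b)
  · refine (close_le_iff γ _ _).2 (le_trans ?_ (γ.toClosureOperator.le_closure _))
    exact mul_le_mul' (γ.toClosureOperator.le_closure a) (γ.toClosureOperator.le_closure b)

instance : Monoid (NuclearImage γ) where
  mul_assoc a b c := by
    rw [← close_coe γ a, ← close_coe γ b, ← close_coe γ c]
    simp only [close_mul_close, mul_assoc]
  one_mul a := by
    rw [← close_coe γ a, one_def, close_mul_close, one_mul]
  mul_one a := by
    rw [← close_coe γ a, one_def, close_mul_close, mul_one]

end Order

section Comm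

variable {M : Type u} [CommMonoid M] [PartialOrder M] [MulLeftMono M] [MulRightMono M]
  (γ : Nucleus M)

instance : CommMonoid (NuclearImage γ) where
  mul_comm a b := by rw [mul_def, mul_def, mul_comm]

end Comm

section Join

variable {M : Type u} [Monoid M] [SemilatticeSup M] (γ : Nucleus M)

/-- Joins in the nuclear image are closures of joins in `M`. -/
instance : SemilatticeSup (NuclearImage γ) where
  sup a b := close γ (a.1 ⊔ b.1)
  le_sup_left a _ := le_trans (a := a.1) le_sup_left (γ.toClosureOperator.le_closure _)
  le_sup_right _ b := le_trans (a := b.1) le_sup_right (γ.toClosureOperator.le_closure _)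
  sup_le _ _ _ h₁ h₂ := (close_le_iff γ _ _).2 (sup_le h₁ h₂)

theorem sup_def (a b : NuclearImage γ) : a ⊔ b = close γ (a.1 ⊔ b.1) := rfl

theorem close_sup_close (a b : M) : close γ a ⊔ close γ b = close γ (a ⊔ b) := by
  apply le_antisymm
  · exact sup_le
      ((close_le_iff γ _ _).2 (le_trans le_sup_left (γ.toClosureOperator.le_closure _)))
      ((close_le_iff γ _ _).2 (le_trans le_sup_right (γ.toClosureOperator.le_closure _)))
  · exact (close_le_iff γ _ _).2 (le_trans
      (sup_le_sup (γ.toClosureOperator.le_closure a) (γ.toClosureOperator.le_closure b))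
      (γ.toClosureOperator.le_closure _))

instance [IsSlMonoid M] : IsSlMonoid (NuclearImage γ) where
  mul_sup a b c := by
    rw [← close_coe γ a, ← close_coe γ b, ← close_coe γ c]
    simp only [close_mul_close, close_sup_close, IsSlMonoid.mul_sup]
  sup_mul a b c := by
    rw [← close_coe γ a, ← close_coe γ b, ← close_coe γ c]
    simp only [close_mul_close, close_sup_close, IsSlMonoid.sup_mul]

end Join

end NuclearImage

end Pomonoid

/-- `M` is (up to isomorphism) the nuclear image of the sl-monoid `N` with respect to some
nucleus. An order isomorphism preserves joins and an isomorphism of semigroups preserves the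
unit, so `≃*o` is isomorphism of sl-monoids. -/
def IsNuclearImageOf (M : Type u) [Monoid M] [SemilatticeSup M]
    (N : Type v) [Monoid N] [SemilatticeSup N] [IsSlMonoid N] : Prop :=
  ∃ γ : Pomonoid.Nucleus N, Nonempty (M ≃*o Pomonoid.NuclearImage γ)

/-- A sub-sl-monoid: a submonoid closed under binary joins. -/
structure SubSlMonoid (M : Type u) [Monoid M] [SemilatticeSup M] extends Submonoid M where
  sup_mem' : ∀ {a b : M}, a ∈ carrier → b ∈ carrier → a ⊔ b ∈ carrier

namespace SubSlMonoid

section Basic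

variable {M : Type u} [Monoid M] [SemilatticeSup M]

instance : SetLike (SubSlMonoid M) M where
  coe S := S.carrier
  coe_injective := by
    rintro ⟨S, _⟩ ⟨T, _⟩ h
    congr
    exact SetLike.coe_injective h

instance : SubmonoidClass (SubSlMonoid M) M where
  mul_mem {S} := S.mul_mem'
  one_mem S := S.one_mem'

/-- The order and the joins are those of `M`. -/
instance (S : SubSlMonoid M) : SemilatticeSup S :=
  Subtype.semilatticeSup fun _ _ ha hb => S.sup_mem' ha hb

instance [IsSlMonoid M] (S : SubSlMonoid M) : IsSlMonoid S where
  mul_sup a b c := Subtype.ext (IsSlMonoid.mul_sup a.1 b.1 c.1)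
  sup_mul a b c := Subtype.ext (IsSlMonoid.sup_mul a.1 b.1 c.1)

end Basic

/-- The negative cone of an Abelian lattice-ordered group, as a sub-sl-monoid. -/
def negativeCone (G : Type u) [CommGroup G] [Lattice G] [IsOrderedMonoid G] : SubSlMonoid G where
  carrier := {a : G | a ≤ 1}
  mul_mem' ha hb := mul_le_one' ha hb
  one_mem' := le_refl (1 : G)
  sup_mem' ha hb := sup_le ha hb

end SubSlMonoid

open Pomonoid

/-! ### Images of cancellative sl-monoids -/

section CancellativeToImage

variable {N : Type u} [CommMonoid N] [SemilatticeSup N] [IsSlMonoid N]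

/-! In a commutative cancellative sl-monoid `a ^ n ≤ b ^ n` implies `a ≤ b`. Multiplying the columns
of a table gives `(∏ x) ^ n ≤ y ^ n`, hence the square condition, which passes to nuclear images, as
does integral closedness.

Conversely, take the free Abelian group on the letters of `M`, and let `P` be the submonoid
generated by the quotients `b / w` with `w` a word whose product in `M` is at most `b`. Up to roots,
`P` is the preimage of the positive cone of an Abelian ℓ-group `G` (`Submonoid.exists_lattice_hom`).
The point is that `G` adds no inequality between a word and a letter: if `(y / w) ^ n` lies in `P`,
substitution and integral closedness rewrite `n` copies of `w` as `n` words with products below `y`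
(`exists_words`), and the square condition gives `w.prod ≤ y`. Thus products of words and finite
joins of their images in `G` have the same upper bounds among letters. This yields a multiplicative
left adjoint onto `M`, that is, a nucleus. -/

theorem Pomonoid.Cancellative.le_of_pow_le_pow (hN : Cancellative N) {n : ℕ} (hn : n ≠ 0) {a b : N}
    (h : a ^ n ≤ b ^ n) : a ≤ b := by
  obtain ⟨k, rfl⟩ := Nat.exists_eq_succ_of_ne_zero hn
  have hb : b ^ (k + 1) ≤ b * (a ⊔ b) ^ k := by
    rw [pow_succ']
    exact mul_le_mul_right (pow_le_pow_left' le_sup_right k) b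
  -- Factors `a` are traded one by one for `a ⊔ b`; at `j = k` a single `a` is left and `(a ⊔ b) ^
  -- k` cancels.
  have key : ∀ j ≤ k, a ^ (k + 1 - j) * (a ⊔ b) ^ j ≤ b * (a ⊔ b) ^ k := by
    intro j
    induction j with
    | zero => intro _; simpa using h.trans hb
    | succ j ih =>
      intro hj
      have e : k + 1 - j = (k + 1 - (j + 1)) + 1 := by omega
      rw [pow_succ', ← mul_assoc, IsSlMonoid.mul_sup, IsSlMonoid.sup_mul, ← pow_succ, ← e]
      refine sup_le (ih (by omega)) ?_
      calc a ^ (k + 1 - (j + 1)) * b * (a ⊔ b) ^ j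
          ≤ (a ⊔ b) ^ (k + 1 - (j + 1)) * b * (a ⊔ b) ^ j := by
            gcongr
            exact le_sup_left
        _ = b * (a ⊔ b) ^ k := by
            rw [mul_comm _ b, mul_assoc, ← pow_add]
            congr 2
            omega
  have h1 := key k le_rfl
  rw [Nat.add_sub_cancel_left, pow_one] at h1
  exact hN.1 _ _ _ h1

/-- The closure map of a nucleus as a monoid homomorphism onto the nuclear image. -/
def Pomonoid.NuclearImage.closeHom (γ : Nucleus N) : N →* NuclearImage γ where
  toFun := NuclearImage.close γ
  map_one' := rfl
  map_mul' a b := (NuclearImage.close_mul_close γ a b).symm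

theorem Pomonoid.Cancellative.integrallyClosed_nuclearImage (hN : Cancellative N)
    (γ : Nucleus N) : IntegrallyClosed (NuclearImage γ) := by
  have key : ∀ a x : NuclearImage γ, x * a ≤ a → x ≤ 1 := by
    intro a x h
    rw [NuclearImage.mul_def, NuclearImage.close_le_iff] at h
    have h1 : x.1 ≤ 1 := hN.1 _ _ a.1 (by rwa [one_mul])
    exact h1.trans (γ.toClosureOperator.le_closure 1)
  exact ⟨fun a x h => key a x (by rwa [mul_comm]), key⟩

theorem prod_prod_tableCell {M : Type u} [CommMonoid M] {n m : ℕ} (f : Fin n → Fin m → Fin n)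
    (x : Fin m → M) : ∏ j, ∏ i, tableCell f x i j = (∏ k, x k) ^ n := by
  rw [Finset.prod_comm]
  have h : ∀ i, ∏ j, tableCell f x i j = ∏ k, x k := fun i =>
    Finset.prod_fiberwise Finset.univ (f i) x
  simp [h]

theorem map_tableCell {M : Type u} {M' : Type v} [CommMonoid M] [CommMonoid M'] (g : M →* M')
    {n m : ℕ} (f : Fin n → Fin m → Fin n) (x : Fin m → M) (i j : Fin n) :
    tableCell f (fun k => g (x k)) i j = g (tableCell f x i j) :=
  (map_prod g _ _).symm

theorem Pomonoid.Cancellative.squareCondition_nuclearImage (hN : Cancellative N)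
    (γ : Nucleus N) : SquareCondition (NuclearImage γ) := by
  intro n m hn f x y h
  have hx : x = fun k => NuclearImage.closeHom γ (x k).1 :=
    funext fun k => (NuclearImage.close_coe γ (x k)).symm
  rw [hx] at h ⊢
  simp only [map_tableCell, ← map_prod] at h ⊢
  refine (NuclearImage.close_le_iff γ _ _).2 (hN.le_of_pow_le_pow (n := n) (by omega) ?_)
  rw [← prod_prod_tableCell f]
  calc _ ≤ ∏ _j : Fin n, y.1 :=
        Finset.prod_le_prod' fun j _ => (NuclearImage.close_le_iff γ _ _).1 (h j)
    _ = y.1 ^ n := by simp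

theorem Pomonoid.Integral.nuclearImage (hN : Integral N) (γ : Nucleus N) :
    Integral (NuclearImage γ) := fun a =>
  le_trans (b := a.1) le_rfl ((hN a.1).trans (γ.toClosureOperator.le_closure 1))

end CancellativeToImage

/-! ### Invariance under isomorphism -/

section Transfer

variable {M : Type u} [CommMonoid M] [PartialOrder M] {N : Type v} [CommMonoid N] [PartialOrder N]

theorem Pomonoid.IntegrallyClosed.of_equiv (e : M ≃*o N) (h : IntegrallyClosed N) :
    IntegrallyClosed M := by
  constructor
  · intro a x hx
    have := h.1 (e a) (e x) (by rw [← map_mul]; exact (map_le_map_iff e).2 hx)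
    rw [← map_one e] at this
    exact (map_le_map_iff e).1 this
  · intro a x hx
    have := h.2 (e a) (e x) (by rw [← map_mul]; exact (map_le_map_iff e).2 hx)
    rw [← map_one e] at this
    exact (map_le_map_iff e).1 this

theorem Pomonoid.Integral.of_equiv (e : M ≃*o N) (h : Integral N) : Integral M := by
  intro a
  have := h (e a)
  rw [← map_one e] at this
  exact (map_le_map_iff e).1 this

theorem Pomonoid.SquareCondition.of_equiv (e : M ≃*o N) (h : SquareCondition N) :
    SquareCondition M := by
  intro n m hn f x y hy
  have := h n m hn f (fun k => (e : M →* N) (x k)) (e y) (by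
    intro j
    simp only [map_tableCell, ← map_prod]
    exact (map_le_map_iff e).2 (hy j))
  rw [← map_prod] at this
  exact (map_le_map_iff e).1 this

end Transfer

theorem SubSlMonoid.cancellative {M : Type u} [CommMonoid M] [SemilatticeSup M]
    (h : Cancellative M) (S : SubSlMonoid M) : Cancellative S :=
  ⟨fun a b x hx => h.1 a.1 b.1 x.1 hx, fun a b x hx => h.2 a.1 b.1 x.1 hx⟩

theorem Pomonoid.cancellative_of_group (G : Type u) [CommGroup G] [PartialOrder G]
    [IsOrderedMonoid G] : Cancellative G :=
  ⟨fun _ _ _ h => le_of_mul_le_mul_right' h, fun _ _ _ h => le_of_mul_le_mul_left' h⟩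

/-! ### Nuclei from Galois connections -/

section Retract

variable {M : Type u} [CommMonoid M] [SemilatticeSup M]
  {N : Type v} [CommMonoid N] [SemilatticeSup N] [IsSlMonoid N]

/-- A multiplicative map with a right adjoint section exhibits its codomain as a nuclear image. -/
theorem IsNuclearImageOf.of_galoisConnection (c : N → M) (x : M → N) (gc : GaloisConnection c x)
    (hc : ∀ s t, c (s * t) = c s * c t) (hx : ∀ b, c (x b) = b) : IsNuclearImageOf M N := by
  let γ : Nucleus N :=
    { gc.closureOperator with
      map_mul_le' := by
        intro s t
        change x (c s) * x (c t) ≤ x (c (s * t))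
        rw [← gc.le_iff_le, hc, hx, hx, hc] }
  refine ⟨γ, ⟨⟨⟨⟨fun b => ⟨x b, congrArg x (hx b)⟩, fun s => c s.1, hx, fun s => Subtype.ext s.2⟩,
    ?_⟩, ?_⟩⟩⟩
  · intro a b
    refine Subtype.ext ?_
    change x (a * b) = x (c (x a * x b))
    rw [hc, hx, hx]
  · intro a b
    change x a ≤ x b ↔ a ≤ b
    rw [← gc.le_iff_le, hx]

end Retract

/-! ### Orders on Abelian groups extending a submonoid -/

section Spanning

variable {F : Type u} [CommGroup F]

/-- By Zorn, take `T` maximal among the submonoids containing `P` and avoiding `C`; maximality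
forces it to contain `g` or `g⁻¹`. -/
theorem Submonoid.exists_isMulSpanning {P : Submonoid F} {C : Subsemigroup F}
    (h : ∀ g ∈ P, g ∉ C) : ∃ T : Submonoid F, P ≤ T ∧ T.IsMulSpanning ∧ ∀ g ∈ T, g ∉ C := by
  obtain ⟨T, hPT, hT⟩ := zorn_le_nonempty₀ {T : Submonoid F | ∀ g ∈ T, g ∉ C} (by
    intro c hc hchain y hy
    refine ⟨sSup c, ?_, fun z hz => le_sSup hz⟩
    intro g hg
    obtain ⟨T, hTc, hgT⟩ := (Submonoid.mem_sSup_of_directedOn ⟨y, hy⟩ hchain.directedOn).1 hg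
    exact hc hTc g hgT) P h
  refine ⟨T, hPT, ?_, hT.1⟩
  have key : ∀ g ∉ T, ∃ t ∈ T, ∃ a : ℕ, a ≠ 0 ∧ t * g ^ a ∈ C := by
    intro g hg
    by_contra! hcon
    have hle : T ≤ T ⊔ Submonoid.powers g := le_sup_left
    refine hg (hT.2 (y := T ⊔ Submonoid.powers g) ?_ hle
      (le_sup_right (a := T) (Submonoid.mem_powers g)))
    intro z hz
    obtain ⟨t, ht, _, ⟨a, rfl⟩, rfl⟩ := Submonoid.mem_sup.1 hz
    rcases eq_or_ne a 0 with rfl | ha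
    · simpa using hT.1 t ht
    · exact hcon t ht a ha
  have powC : ∀ z ∈ C, ∀ n : ℕ, n ≠ 0 → z ^ n ∈ C := by
    intro z hz n hn
    obtain ⟨k, rfl⟩ := Nat.exists_eq_succ_of_ne_zero hn
    induction k with
    | zero => simpa using hz
    | succ k ih => rw [pow_succ]; exact C.mul_mem (ih (by omega)) hz
  intro g
  by_contra! hg
  obtain ⟨t, ht, a, ha, hta⟩ := key g hg.1
  obtain ⟨s, hs, b, hb, hsb⟩ := key g⁻¹ hg.2
  -- These exponents cancel the powers of `g` in `(t * g ^ a) ^ b * (s * g⁻¹ ^ b) ^ a`, which lies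
  -- in `C`.
  refine hT.1 (t ^ b * s ^ a) (mul_mem (pow_mem ht b) (pow_mem hs a)) ?_
  have := C.mul_mem (powC _ hta b hb) (powC _ hsb a ha)
  convert this using 1
  rw [mul_pow, mul_pow, inv_pow, inv_pow, ← pow_mul, ← pow_mul, mul_comm b a,
    mul_mul_mul_comm, mul_inv_cancel, mul_one]

/-- `T` is the positive cone of a total preorder; the quotient by its units makes the order
antisymmetric. -/
theorem Submonoid.IsMulSpanning.exists_linearOrder {T : Submonoid F} (hT : T.IsMulSpanning) :
    ∃ (L : Type u) (_ : CommGroup L) (_ : LinearOrder L) (_ : IsOrderedMonoid L) (φ : F →* L),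
      ∀ g, 1 ≤ φ g ↔ g ∈ T := by
  classical
  have hmem : ∀ g : F, (g : F ⧸ T.mulSupport) ∈ T.map (QuotientGroup.mk' T.mulSupport) ↔ g ∈ T := by
    intro g
    constructor
    · rintro ⟨t, ht, h⟩
      have h' := (QuotientGroup.eq.1 h).1
      simpa using mul_mem (show t ∈ T from ht) h'
    · exact fun hg => ⟨g, hg, rfl⟩
  let C : GroupCone (F ⧸ T.mulSupport) :=
    { T.map (QuotientGroup.mk' T.mulSupport) with
      eq_one_of_mem_of_inv_mem' := by
        intro a
        induction a using QuotientGroup.induction_on with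
        | H g =>
          intro h1 h2
          exact (QuotientGroup.eq_one_iff g).2 ⟨(hmem g).1 h1, (hmem g⁻¹).1 h2⟩ }
  have : HasMemOrInvMem C := ⟨by
    intro a
    induction a using QuotientGroup.induction_on with
    | H g => exact (hT g).imp (hmem g).2 (hmem g⁻¹).2⟩
  refine ⟨F ⧸ T.mulSupport, inferInstance, LinearOrder.mkOfGroupCone C,
    IsOrderedMonoid.mkOfCone C, QuotientGroup.mk' T.mulSupport, fun g => ?_⟩
  change (g : F ⧸ T.mulSupport) / 1 ∈ C ↔ _
  rw [div_one]
  exact hmem g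

/-- Every submonoid of an Abelian group is, up to roots, the preimage of the positive cone under a
homomorphism to an Abelian lattice-ordered group. -/
theorem Submonoid.exists_lattice_hom (P : Submonoid F) :
    ∃ (G : Type u) (_ : CommGroup G) (_ : Lattice G) (_ : IsOrderedMonoid G) (φ : F →* G),
      ∀ g, 1 ≤ φ g ↔ ∃ n : ℕ, n ≠ 0 ∧ g ^ n ∈ P := by
  have key : ∀ g : {g : F // ∀ n : ℕ, n ≠ 0 → g ^ n ∉ P},
      ∃ (L : Type u) (_ : CommGroup L) (_ : LinearOrder L) (_ : IsOrderedMonoid L) (φ : F →* L),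
        (∀ p ∈ P, 1 ≤ φ p) ∧ ¬ 1 ≤ φ g.1 := by
    intro g
    -- Avoiding all positive powers of `g` yields a linear order separating `g` from `P`; `G` is the
    -- product of these over all such `g`.
    let C : Subsemigroup F :=
      { carrier := {z | ∃ n : ℕ, n ≠ 0 ∧ g.1 ^ n = z}
        mul_mem' := by
          rintro _ _ ⟨n, hn, rfl⟩ ⟨k, hk, rfl⟩
          exact ⟨n + k, by omega, pow_add _ _ _⟩ }
    obtain ⟨T, hPT, hT, hTC⟩ := P.exists_isMulSpanning (C := C) (by
      rintro _ hz ⟨n, hn, rfl⟩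
      exact g.2 n hn hz)
    obtain ⟨L, i₁, i₂, i₃, φ, hφ⟩ := hT.exists_linearOrder
    exact ⟨L, i₁, i₂, i₃, φ, fun p hp => (hφ p).2 (hPT hp),
      fun h => hTC _ ((hφ _).1 h) ⟨1, one_ne_zero, pow_one _⟩⟩
  choose L i₁ i₂ i₃ φ hφ hφ' using key
  refine ⟨∀ g, L g, inferInstance, inferInstance, inferInstance, MonoidHom.pi φ, fun g => ?_⟩
  constructor
  · intro h
    by_contra! hcon
    exact hφ' ⟨g, hcon⟩ (h ⟨g, hcon⟩)
  · rintro ⟨n, hn, h⟩ i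
    have := hφ i _ h
    rw [map_pow] at this
    exact (one_le_pow_iff hn).1 this

end Spanning

/-! ### Balances of words and the square condition -/

section Words

variable {M : Type u}

/-- Turns an equality of multisets into an assignment of occurrences to columns, as a table
requires. -/
theorem Finset.exists_fiber_map_eq {A B : Type*} [DecidableEq A] [Fintype B] [DecidableEq B]
    [Nonempty B]
    (l : A → M) (s : Finset A) (J : B → Multiset M) (h : s.val.map l = ∑ j, J j) :
    ∃ f : A → B, ∀ j, (s.filter (fun a => f a = j)).val.map l = J j := by
  classical
  induction s using Finset.induction_on generalizing J with
  | empty =>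
    refine ⟨fun _ => Classical.arbitrary B, fun j => ?_⟩
    have h0 : ∑ j, J j = 0 := h.symm
    simpa using ((Finset.sum_eq_zero_iff.1 h0) j (Finset.mem_univ j)).symm
  | insert a s ha ih =>
    have hmem : l a ∈ ∑ j, J j := by rw [← h]; simp
    obtain ⟨j₀, -, hj₀⟩ := Multiset.mem_sum.1 hmem
    obtain ⟨t, ht⟩ := Multiset.exists_cons_of_mem hj₀
    obtain ⟨f, hf⟩ := ih (Function.update J j₀ t) (by
      have h1 := Finset.add_sum_erase Finset.univ J (Finset.mem_univ j₀)
      have h2 := Finset.add_sum_erase Finset.univ (Function.update J j₀ t) (Finset.mem_univ j₀)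
      rw [Function.update_self, Finset.sum_congr rfl (g := J) (fun j hj => by
        rw [Function.update_of_ne (Finset.ne_of_mem_erase hj)])] at h2
      rw [← h2]
      rw [← h1, ht, Finset.insert_val_of_notMem ha, Multiset.map_cons, Multiset.cons_add] at h
      exact (Multiset.cons_inj_right _).1 h)
    refine ⟨Function.update f a j₀, fun j => ?_⟩
    have hs : s.filter (fun b => Function.update f a j₀ b = j) = s.filter (fun b => f b = j) :=
      Finset.filter_congr fun b hb => by
        rw [Function.update_of_ne (ne_of_mem_of_not_mem hb ha)]
    rw [Finset.filter_insert, hs, Function.update_self]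
    split_ifs with hj
    · subst hj
      rw [Finset.insert_val_of_notMem (by simp [ha]), Multiset.map_cons, hf, Function.update_self,
        ht]
    · rw [hf, Function.update_of_ne (Ne.symm hj)]

variable [CommMonoid M] [PartialOrder M]

theorem Pomonoid.SquareCondition.prod_le (hM : SquareCondition M) {n : ℕ} (hn : n ≠ 0)
    {w : Multiset M} {y : M} (J : Fin n → Multiset M) (hJ : ∀ j, (J j).prod ≤ y)
    (h : n • w = ∑ j, J j) : w.prod ≤ y := by
  obtain ⟨l, rfl⟩ := Quot.exists_rep w
  have hw : (Finset.univ : Finset (Fin l.length)).val.map l.get = (l : Multiset M) := by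
    simp [Fin.univ_def]
  have : Nonempty (Fin n) := ⟨⟨0, by omega⟩⟩
  obtain ⟨f, hf⟩ := Finset.exists_fiber_map_eq (fun p : Fin n × Fin l.length => l.get p.2)
    Finset.univ J (by
      rw [← h]
      have hg : ∀ (g : Fin n × Fin l.length → M),
          Finset.univ.val.map g = ∑ i, ∑ k, {g (i, k)} := fun g => by
        rw [← Fintype.sum_prod_type' (f := fun i k => ({g (i, k)} : Multiset M))]
        exact (Multiset.sum_map_singleton _).symm.trans (by rw [Multiset.map_map]; rfl)
      have hl : ∑ k, ({l.get k} : Multiset M) = (l : Multiset M) := by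
        rw [← hw]
        exact (by rw [Multiset.map_map]; rfl : _ = _).trans (Multiset.sum_map_singleton _)
      rw [hg]
      simp only [hl, Finset.sum_const, Finset.card_univ, Fintype.card_fin]
      rfl)
  have := hM n l.length (by omega) (fun i k => f (i, k)) l.get y (by
    intro j
    refine le_of_eq_of_le ?_ (hJ j)
    rw [← hf j]
    change _ = ∏ p : Fin n × Fin l.length with f p = j, l.get p.2
    simp only [tableCell, Finset.prod_filter, Fintype.prod_prod_type])
  refine le_of_eq_of_le ?_ this
  change (l : Multiset M).prod = _
  rw [← hw]
  rfl

/-- Inequalities `r ≤ b` between words and letters can be eliminated from a balance of words. -/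
theorem Pomonoid.IntegrallyClosed.exists_words [MulLeftMono M] (hM : IntegrallyClosed M) {y : M}
    (U : Multiset M) (L : Multiset (Multiset M × M)) (hL : ∀ p ∈ L, p.1.prod ≤ p.2)
    (J : Multiset (Multiset M)) (hJ : ∀ w ∈ J, w.prod ≤ y) (hJ0 : J ≠ 0)
    (h : U + L.map Prod.snd = J.sum + (L.map Prod.fst).sum) :
    ∃ J' : Multiset (Multiset M), J'.card = J.card ∧ (∀ w ∈ J', w.prod ≤ y) ∧ U = J'.sum := by
  induction hk : L.card generalizing L J with
  | zero =>
    obtain rfl := Multiset.card_eq_zero.1 hk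
    exact ⟨J, rfl, hJ, by simpa using h⟩
  | succ k ih =>
    obtain ⟨⟨r, b⟩, hrb⟩ := Multiset.card_pos_iff_exists_mem.1 (by omega : 0 < L.card)
    obtain ⟨L, rfl⟩ := Multiset.exists_cons_of_mem hrb
    have hr : r.prod ≤ b := hL _ hrb
    have hL' : ∀ p ∈ L, p.1.prod ≤ p.2 := fun p hp => hL p (Multiset.mem_cons_of_mem hp)
    have hcard : L.card = k := by simpa using hk
    simp only [Multiset.map_cons, Multiset.sum_cons] at h
    rw [← Multiset.singleton_add] at h
    have hb : b ∈ J.sum + (r + (L.map Prod.fst).sum) := by rw [← h]; simp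
    rw [Multiset.mem_add, Multiset.mem_add] at hb
    -- The letter `b` must recur on the right: in a word of `J`, in `r` itself, or in the word of
    -- another inequality. In the outer cases, replacing it there by `r` only decreases the product.
    rcases hb with hb | hb | hb
    · obtain ⟨w, hw, hbw⟩ := Multiset.mem_join.1 hb
      obtain ⟨J, rfl⟩ := Multiset.exists_cons_of_mem hw
      obtain ⟨s, rfl⟩ := Multiset.exists_cons_of_mem hbw
      have := ih L hL' ((r + s) ::ₘ J) (by
        intro w hw
        rcases Multiset.mem_cons.1 hw with rfl | hw
        · rw [Multiset.prod_add]
          refine (mul_le_mul_left hr s.prod).trans ?_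
          simpa using hJ _ (Multiset.mem_cons_self _ _)
        · exact hJ w (Multiset.mem_cons_of_mem hw)) (Multiset.cons_ne_zero) (by
        rw [Multiset.sum_cons, ← Multiset.singleton_add _ s] at h
        rw [Multiset.sum_cons]
        refine add_left_cancel (a := {b}) ?_
        convert h using 1 <;> abel) hcard
      simpa using this
    · obtain ⟨s, rfl⟩ := Multiset.exists_cons_of_mem hb
      -- Here `r` is `b` times `s`, so integral closedness applies; `s` is then absorbed into any
      -- word of `J`.
      have hs : s.prod ≤ 1 := hM.1 b _ (by simpa using hr)
      obtain ⟨w, hw⟩ := Multiset.exists_mem_of_ne_zero hJ0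
      obtain ⟨J, rfl⟩ := Multiset.exists_cons_of_mem hw
      have := ih L hL' ((w + s) ::ₘ J) (by
        intro w' hw'
        rcases Multiset.mem_cons.1 hw' with rfl | hw'
        · rw [Multiset.prod_add]
          refine (mul_le_mul_right hs w.prod).trans ?_
          simpa using hJ _ (Multiset.mem_cons_self _ _)
        · exact hJ w' (Multiset.mem_cons_of_mem hw')) (Multiset.cons_ne_zero) (by
        rw [Multiset.sum_cons, ← Multiset.singleton_add _ s] at h
        rw [Multiset.sum_cons]
        refine add_left_cancel (a := {b}) ?_
        convert h using 1 <;> abel) hcard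
      simpa using this
    · obtain ⟨_, hw, hbw⟩ := Multiset.mem_join.1 hb
      obtain ⟨⟨w, b'⟩, hp, rfl⟩ := Multiset.mem_map.1 hw
      obtain ⟨L, rfl⟩ := Multiset.exists_cons_of_mem hp
      obtain ⟨s, hs⟩ := Multiset.exists_cons_of_mem hbw
      obtain rfl : w = b ::ₘ s := hs
      refine ih ((r + s, b') ::ₘ L) ?_ J hJ hJ0 ?_ (by simpa using hcard)
      · intro p hp
        rcases Multiset.mem_cons.1 hp with rfl | hp
        · change (r + s).prod ≤ b'
          rw [Multiset.prod_add]
          refine (mul_le_mul_left hr s.prod).trans ?_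
          simpa using hL' _ (Multiset.mem_cons_self _ _)
        · exact hL' p (Multiset.mem_cons_of_mem hp)
      · simp only [Multiset.map_cons, Multiset.sum_cons] at h ⊢
        simp only [← Multiset.singleton_add] at h ⊢
        refine add_left_cancel (a := {b}) ?_
        convert h using 1 <;> abel

/-- The square condition and integral closedness exclude new inequalities between a word and a
letter. -/
theorem Pomonoid.SquareCondition.prod_le_of_balance [MulLeftMono M] (hM : IntegrallyClosed M)
    (hS : SquareCondition M) {n : ℕ} (hn : n ≠ 0) (w : Multiset M) (y : M)
    (L : Multiset (Multiset M × M)) (hL : ∀ p ∈ L, p.1.prod ≤ p.2)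
    (h : n • w + L.map Prod.snd = n • {y} + (L.map Prod.fst).sum) : w.prod ≤ y := by
  -- The `n` copies of `y` become the `n` columns; the rows are the `n` copies of `w`.
  obtain ⟨J, hJn, hJy, hJ⟩ := hM.exists_words (y := y) (n • w) L hL (Multiset.replicate n {y})
    (fun u hu => by rw [Multiset.eq_of_mem_replicate hu, Multiset.prod_singleton])
    (fun e => hn (by simpa using congrArg Multiset.card e))
    (by rw [Multiset.sum_replicate]; exact h)
  obtain ⟨l, rfl⟩ := Quot.exists_rep J
  obtain rfl : l.length = n := by simpa using hJn
  refine hS.prod_le hn l.get (fun j => hJy _ (l.get_mem j)) ?_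
  rw [hJ]
  change (l : Multiset (Multiset M)).sum = ∑ j, l.get j
  rw [Multiset.sum_coe, ← List.sum_ofFn, List.ofFn_get]

end Words

/-! ### The homomorphism from words to an ℓ-group -/

section Embedding

variable {M : Type u} [CommMonoid M]

/-- The group elements whose positivity follows from finitely many inequalities between a word
and a letter. -/
def Pomonoid.wordCone (M : Type u) [CommMonoid M] [PartialOrder M] :
    Submonoid (Algebra.GrothendieckGroup (Multiplicative (Multiset M))) where
  carrier := {g | ∃ L : Multiset (Multiset M × M), (∀ p ∈ L, p.1.prod ≤ p.2) ∧
    g * Algebra.GrothendieckGroup.of (Multiplicative.ofAdd (L.map Prod.fst).sum) =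
      Algebra.GrothendieckGroup.of (Multiplicative.ofAdd (L.map Prod.snd))}
  one_mem' := ⟨0, by simp, by simp⟩
  mul_mem' := by
    rintro a b ⟨L, hL, ha⟩ ⟨L', hL', hb⟩
    refine ⟨L + L', fun p hp => (Multiset.mem_add.1 hp).elim (hL p) (hL' p), ?_⟩
    rw [Multiset.map_add, Multiset.map_add, Multiset.sum_add, ofAdd_add, ofAdd_add, map_mul,
      map_mul, ← ha, ← hb, mul_mul_mul_comm]

theorem Pomonoid.SquareCondition.exists_hom [PartialOrder M] [MulLeftMono M]
    (hM : IntegrallyClosed M) (hS : SquareCondition M) :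
    ∃ (G : Type u) (_ : CommGroup G) (_ : Lattice G) (_ : IsOrderedMonoid G)
      (e : Multiplicative (Multiset M) →* G),
      ∀ (w : Multiplicative (Multiset M)) (b : M),
        e w ≤ e (Multiplicative.ofAdd {b}) ↔ w.toAdd.prod ≤ b := by
  obtain ⟨G, i₁, i₂, i₃, φ, hφ⟩ := (wordCone M).exists_lattice_hom
  refine ⟨G, i₁, i₂, i₃, φ.comp Algebra.GrothendieckGroup.of, fun w b => ?_⟩
  rw [MonoidHom.comp_apply, MonoidHom.comp_apply, ← one_le_div', ← map_div, hφ]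
  constructor
  · rintro ⟨n, hn, L, hL, h⟩
    refine hS.prod_le_of_balance hM hn w.toAdd b L hL ?_
    have h' : Multiplicative.ofAdd {b} ^ n * Multiplicative.ofAdd (L.map Prod.fst).sum =
        Multiplicative.ofAdd (L.map Prod.snd) * w ^ n :=
      Algebra.GrothendieckGroup.of_injective <| by
        rw [map_mul, map_mul, map_pow, map_pow, ← h, div_pow, mul_right_comm, div_mul_cancel]
    exact (add_comm _ _).trans (congrArg Multiplicative.toAdd h'.symm)
  · intro h
    refine ⟨1, one_ne_zero, {(w.toAdd, b)}, by simpa using h, ?_⟩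
    simp

/-- The letter `1` is idempotent in `M`, so its image is at most the unit of `G`, and by integrality
it bounds the image of every word. -/
theorem MonoidHom.le_one_of_integral [PartialOrder M] {G : Type v} [CommGroup G] [PartialOrder G]
    [IsOrderedMonoid G] (hM : Integral M) (e : Multiplicative (Multiset M) →* G)
    (he : ∀ w b, e w ≤ e (Multiplicative.ofAdd {b}) ↔ w.toAdd.prod ≤ b)
    (w : Multiplicative (Multiset M)) : e w ≤ 1 := by
  have h : e (Multiplicative.ofAdd {1} * Multiplicative.ofAdd {1}) ≤ e (Multiplicative.ofAdd {1}) :=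
    (he _ _).2 (by simp)
  rw [map_mul] at h
  exact ((he w 1).2 (hM _)).trans (mul_le_iff_le_one_left'.1 h)

end Embedding

/-! ### Finite joins of words -/

section FiniteSups

open scoped Pointwise

theorem Finset.sup'_mul_hom {A : Type u} {N : Type v} [DecidableEq A] [Monoid A] [Monoid N]
    [SemilatticeSup N] [IsSlMonoid N] (f : A →* N) {V W : Finset A} (hV : V.Nonempty)
    (hW : W.Nonempty) :
    (V * W).sup' (hV.mul hW) f = V.sup' hV f * W.sup' hW f := by
  have h₁ : ∀ t : N, V.sup' hV f * t = V.sup' hV (fun v => f v * t) := fun t =>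
    Finset.apply_sup'_eq_sup'_comp hV (· * t) (fun a b => IsSlMonoid.sup_mul a b t)
  have h₂ : ∀ t : N, t * W.sup' hW f = W.sup' hW (fun w => t * f w) := fun t =>
    Finset.apply_sup'_eq_sup'_comp hW (t * ·) (fun a b => IsSlMonoid.mul_sup t a b)
  refine eq_of_forall_ge_iff fun b => ?_
  simp only [h₁, h₂, Finset.sup'_le_iff]
  exact ⟨fun h v hv w hw => (map_mul f v w).symm.trans_le (h _ (Finset.mul_mem_mul hv hw)),
    fun h z hz => by
      obtain ⟨v, hv, w, hw, rfl⟩ := Finset.mem_mul.1 hz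
      exact (map_mul f v w).trans_le (h v hv w hw)⟩

/-- The finite nonempty joins of elements in the range of a monoid homomorphism. -/
def MonoidHom.finiteSups {A : Type u} {N : Type v} [Monoid A] [Monoid N] [SemilatticeSup N]
    [IsSlMonoid N] (f : A →* N) : SubSlMonoid N where
  carrier := {g | ∃ (W : Finset A) (hW : W.Nonempty), W.sup' hW f = g}
  one_mem' := ⟨{1}, Finset.singleton_nonempty 1, by simp⟩
  mul_mem' := by
    classical
    rintro _ _ ⟨V, hV, rfl⟩ ⟨W, hW, rfl⟩
    exact ⟨V * W, hV.mul hW, Finset.sup'_mul_hom f hV hW⟩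
  sup_mem' := by
    classical
    rintro _ _ ⟨V, hV, rfl⟩ ⟨W, hW, rfl⟩
    exact ⟨V ∪ W, hV.mono Finset.subset_union_left, Finset.sup'_union hV hW f⟩

theorem MonoidHom.apply_mem_finiteSups {A : Type u} {N : Type v} [Monoid A] [Monoid N]
    [SemilatticeSup N] [IsSlMonoid N] (f : A →* N) (a : A) : f a ∈ f.finiteSups :=
  ⟨{a}, Finset.singleton_nonempty a, Finset.sup'_singleton f⟩

/-- The product of a word. -/
def Multiset.prodHom (M : Type u) [CommMonoid M] : Multiplicative (Multiset M) →* M where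
  toFun w := w.toAdd.prod
  map_one' := Multiset.prod_zero
  map_mul' v w := Multiset.prod_add v.toAdd w.toAdd

end FiniteSups

/-! ### The nucleus and the main theorem -/

section Main

open scoped Pointwise

variable {M : Type u} [CommMonoid M] [SemilatticeSup M] [IsSlMonoid M]
  {N : Type v} [CommMonoid N] [SemilatticeSup N] [IsSlMonoid N]

theorem MonoidHom.exists_galois_finiteSups (e : Multiplicative (Multiset M) →* N)
    (he : ∀ w b, e w ≤ e (Multiplicative.ofAdd {b}) ↔ w.toAdd.prod ≤ b) :
    ∃ c : e.finiteSups → M,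
      (∀ s b, c s ≤ b ↔ s.1 ≤ e (Multiplicative.ofAdd {b})) ∧
      ∀ s t, c (s * t) = c s * c t := by
  classical
  choose W hW hWs using fun s : e.finiteSups => s.2
  have key : ∀ (V : Finset (Multiplicative (Multiset M))) (hV : V.Nonempty) (b : M),
      V.sup' hV (Multiset.prodHom M) ≤ b ↔ V.sup' hV e ≤ e (Multiplicative.ofAdd {b}) := by
    intro V hV b
    simp only [Finset.sup'_le_iff, he]
    rfl
  -- The chosen representation of `s` is immaterial: by `key`, the upper bounds of this join depend
  -- only on `s`. Multiplicativity follows by comparing upper bounds.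
  refine ⟨fun s => (W s).sup' (hW s) (Multiset.prodHom M), fun s b => ?_, fun s t => ?_⟩
  · rw [key, hWs]
  · refine eq_of_forall_ge_iff fun b => ?_
    rw [← Finset.sup'_mul_hom _ (hW s) (hW t), key, key, Finset.sup'_mul_hom _ (hW s) (hW t), hWs, hWs, hWs]
    rfl

theorem MonoidHom.isNuclearImageOf_finiteSups (e : Multiplicative (Multiset M) →* N)
    (he : ∀ w b, e w ≤ e (Multiplicative.ofAdd {b}) ↔ w.toAdd.prod ≤ b) :
    IsNuclearImageOf M e.finiteSups := by
  obtain ⟨c, hc, hmul⟩ := e.exists_galois_finiteSups he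
  refine IsNuclearImageOf.of_galoisConnection c
    (fun b => ⟨e (Multiplicative.ofAdd {b}), e.apply_mem_finiteSups _⟩) hc hmul fun b => ?_
  refine eq_of_forall_ge_iff fun b' => ?_
  rw [hc, he]
  simp

end Main

theorem mainTheorem5 (M : Type u) [CommMonoid M] [SemilatticeSup M] [IsSlMonoid M] :
    List.TFAE
      [ Pomonoid.IntegrallyClosed M ∧ Pomonoid.SquareCondition M,
        ∃ (N : Type u) (_ : CommMonoid N) (_ : SemilatticeSup N) (_ : IsSlMonoid N),
          Pomonoid.Cancellative N ∧ IsNuclearImageOf M N,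
        ∃ (G : Type u) (_ : CommGroup G) (_ : Lattice G) (_ : IsOrderedMonoid G)
          (S : SubSlMonoid G), IsNuclearImageOf M S ] ∧
    List.TFAE
      [ Pomonoid.IntegrallyClosed M ∧ Pomonoid.Integral M ∧ Pomonoid.SquareCondition M,
        ∃ (N : Type u) (_ : CommMonoid N) (_ : SemilatticeSup N) (_ : IsSlMonoid N),
          Pomonoid.Cancellative N ∧ Pomonoid.Integral N ∧ IsNuclearImageOf M N,
        ∃ (G : Type u) (_ : CommGroup G) (_ : Lattice G) (_ : IsOrderedMonoid G)
          (S : SubSlMonoid G), Pomonoid.Integral S ∧ IsNuclearImageOf M S,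
        ∃ (G : Type u) (_ : CommGroup G) (_ : Lattice G) (_ : IsOrderedMonoid G)
          (S : SubSlMonoid (SubSlMonoid.negativeCone G)), IsNuclearImageOf M S ] := by
  constructor
  · tfae_have 1 → 3 := by
      rintro ⟨hM, hS⟩
      obtain ⟨G, i₁, i₂, i₃, e, he⟩ := hS.exists_hom hM
      exact ⟨G, i₁, i₂, i₃, e.finiteSups, e.isNuclearImageOf_finiteSups he⟩
    tfae_have 3 → 2 := by
      rintro ⟨G, i₁, i₂, i₃, S, h⟩
      exact ⟨S, inferInstance, inferInstance, inferInstance,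
        S.cancellative (cancellative_of_group G), h⟩
    tfae_have 2 → 1 := by
      rintro ⟨N, i₁, i₂, i₃, hN, γ, ⟨f⟩⟩
      exact ⟨(hN.integrallyClosed_nuclearImage γ).of_equiv f,
        (hN.squareCondition_nuclearImage γ).of_equiv f⟩
    tfae_finish
  · tfae_have 1 → 3 := by
      rintro ⟨hM, hI, hS⟩
      obtain ⟨G, i₁, i₂, i₃, e, he⟩ := hS.exists_hom hM
      refine ⟨G, i₁, i₂, i₃, e.finiteSups, ?_, e.isNuclearImageOf_finiteSups he⟩
      rintro ⟨_, W, hW, rfl⟩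
      exact Finset.sup'_le hW _ fun w _ => e.le_one_of_integral hI he w
    tfae_have 1 → 4 := by
      rintro ⟨hM, hI, hS⟩
      obtain ⟨G, i₁, i₂, i₃, e, he⟩ := hS.exists_hom hM
      let e' : Multiplicative (Multiset M) →* SubSlMonoid.negativeCone G :=
        e.codRestrict (SubSlMonoid.negativeCone G) (e.le_one_of_integral hI he)
      exact ⟨G, i₁, i₂, i₃, e'.finiteSups, e'.isNuclearImageOf_finiteSups he⟩
    tfae_have 3 → 2 := by
      rintro ⟨G, i₁, i₂, i₃, S, hS, h⟩
      exact ⟨S, inferInstance, inferInstance, inferInstance,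
        S.cancellative (cancellative_of_group G), hS, h⟩
    tfae_have 4 → 2 := by
      rintro ⟨G, i₁, i₂, i₃, S, h⟩
      exact ⟨S, inferInstance, inferInstance, inferInstance,
        S.cancellative ((SubSlMonoid.negativeCone G).cancellative (cancellative_of_group G)),
        fun s => s.1.2, h⟩
    tfae_have 2 → 1 := by
      rintro ⟨N, i₁, i₂, i₃, hN, hI, γ, ⟨f⟩⟩
      exact ⟨(hN.integrallyClosed_nuclearImage γ).of_equiv f, (hI.nuclearImage γ).of_equiv f,
        (hN.squareCondition_nuclearImage γ).of_equiv f⟩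
    tfae_finish
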